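/- **Setting.** All graphs are finite. A causal Bayesian network (CBN) over a DAG $G$ consists of a measurable space $X_a$ for each node $a$ and a Markov kernel $p(a\mid \mathrm{pa}_G(a))$ from $\prod_{b\in \mathrm{pa}_G(a)}X_b$ to $X_a$ for each node $a$. The interventional distribution $p(\,\cdot\mid do(S=z))$ is the truncated product $\prod_{a\notin S}p(a\mid \mathrm{pa}_G(a))$ with the values of the nodes in $S$ fixed to $z$. An ADMG is a DAG together with bidirected edges $a\leftrightarrow b$ between distinct nodes. Let $L'$ be a DAG whose nodes are divided into endogenous nodes $V$ and exogenous nodes $U$, the latter having no parents. The latent projection of $L'$ is the ADMG on $V$ in which $a\to b$ iff $L'$ has a directed path from $a$ to $b$ with all intermediate nodes in $U$, and $a\leftrightarrow b$ iff $a\ne b$ and some $u\in U$ has directed paths to $a$ and to $b$ with all intermediate nodes in $U$. A CBN over an ADMG $L$ is a CBN over some such DAG $L'$ with latent projection $L$. A DAG $H'$ is a graphical abstraction of a DAG $L'$ if it results from $L'$ by a finite sequence of the following operations: (i) deleting a node that does not have outgoing edges to two different nodes, and adding edges from all its parents to all its children; (ii) merging two nodes into one, which inherits all their incoming and outgoing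 edges (edges between the two disappear). Each node of $H'$ thus stands for a cluster of nodes of $L'$. An ADMG $H$ with node set $V^H$ is a graphical abstraction between ADMGs of the ADMG $L$ if there are DAGs $L'',H''$ with exogenous nodes as above, with latent projections $L$ and $H$, such that $H''$ is a graphical abstraction of $L''$ and each node $C\in V^H$ stands for a cluster of nodes of $L$. These clusters are disjoint; the variable $C$ has domain $Z_C=\prod_{a\in C}X_a$. **Statement.** Consider a CBN with interventional distributions $p$ over an ADMG $L$, and let $H$ be a graphical abstraction between ADMGs of $L$. Then there are finitely many independent random variables $U=(U_i)_{i\in I}$ with joint law $p(U)=\bigotimes_{i\in I}p(U_i)$, subsets $U_C\subseteq U$ for $C\in V^H$, and Markov kernels $p(C\mid \mathrm{pa}_H(C),U_C)$ from $\prod_{D\in \mathrm{pa}_H(C)}Z_D\times\prod_{U_i\in U_C}Y_i$ to $Z_C$ (where $Y_i$ is the domain of $U_i$ and $\mathrm{pa}_H$ denotes parents along directed edges) such that: 1. for all $C\neq C'$ in $V^H$, $U_C\cap U_{C'}\neq\emptyset$ if and only if $H$ has a bidirected edge $C\leftrightarrow C'$; 2. for every set $S\subseteq V^H$ of intervened nodes,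 and all values of these nodes, $$p(V^H\setminus S\mid do(S))=\int_U p(U)\prod_{C\in V^H\setminus S}p(C\mid \mathrm{pa}_H(C),U_C)\,dU .$$ In particular, for every single node $A\in V^H$, $$p(V^H\setminus\{A\}\mid do(A))=\int_U p(U)\prod_{C\in V^H\setminus\{A\}}p(C\mid \mathrm{pa}_H(C),U_C)\,dU .$$ -/

import Mathlib

open MeasureTheory ProbabilityTheory

universe u v w x

/-! ### Directed acyclic graphs, mixed graphs and latent projections -/

/-- A directed acyclic graph on the nodes `N`. -/
structure DAG (N : Type u) where
  /-- `Adj a b` means that there is an edge from `a` to `b`. -/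
  Adj : N → N → Prop
  acyclic : ∀ a, ¬ Relation.TransGen Adj a a

/-- An acyclic directed mixed graph: a directed acyclic graph together with bidirected edges. -/
structure ADMG (V : Type u) extends DAG V where
  /-- `bi a b` means that there is a bidirected edge between `a` and `b`. -/
  bi : V → V → Prop
  bi_symm : ∀ a b, bi a b → bi b a
  bi_irrefl : ∀ a, ¬ bi a a

/-- The parents of a node. -/
def DAG.pa {N : Type u} (G : DAG N) (b : N) : Set N := {a | G.Adj a b}

/-- `G.LatentPath a b`: there is a directed path of positive length from `a` to `b`
all of whose intermediate nodes are latent, i.e. belong to the summand `U`. -/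
inductive DAG.LatentPath {V : Type u} {U : Type v} (G : DAG (V ⊕ U)) : V ⊕ U → V ⊕ U → Prop
  | edge {a b : V ⊕ U} : G.Adj a b → G.LatentPath a b
  | cons {a b : V ⊕ U} {l : U} : G.Adj a (Sum.inr l) → G.LatentPath (Sum.inr l) b →
      G.LatentPath a b

/-- `G`, whose nodes are divided into the endogenous nodes `V` and the nodes `U`, has exogenous
nodes `U` (they have no parents) and latent projection `L`: `a → b` in `L` iff some directed path
leads from `a` to `b` through latent nodes, and `a ↔ b` in `L` iff `a ≠ b` have a common latent
source from which directed paths through latent nodes lead to `a` and to `b`. -/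
structure DAG.HasLatentProjection {V : Type u} {U : Type v} (G : DAG (V ⊕ U)) (L : ADMG V) :
    Prop where
  exogenous : ∀ (a : V ⊕ U) (l : U), ¬ G.Adj a (Sum.inr l)
  dir_iff : ∀ a b : V, L.Adj a b ↔ G.LatentPath (Sum.inl a) (Sum.inl b)
  bi_iff : ∀ a b : V, L.bi a b ↔
    a ≠ b ∧ ∃ l : U, G.LatentPath (Sum.inr l) (Sum.inl a) ∧ G.LatentPath (Sum.inr l) (Sum.inl b)

/-! ### Graphical abstractions -/

/-- A directed graph whose nodes are clusters (sets) of elements of `N`. -/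
structure ClusterGraph (N : Type u) where
  nodes : Set (Set N)
  Adj : Set N → Set N → Prop

namespace ClusterGraph

variable {N : Type u}

/-- A directed acyclic graph, each node being regarded as a one-element cluster. -/
def ofDAG (G : DAG N) : ClusterGraph N where
  nodes := Set.range fun a => {a}
  Adj A B := ∃ a b, A = {a} ∧ B = {b} ∧ G.Adj a b

/-- Delete the node `A` and add edges from all of its parents to all of its children. -/
def delete (K : ClusterGraph N) (A : Set N) : ClusterGraph N where
  nodes := K.nodes \ {A}
  Adj B C := B ≠ A ∧ C ≠ A ∧ B ≠ C ∧ (K.Adj B C ∨ (K.Adj B A ∧ K.Adj A C))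

open Classical in
/-- The node that represents `E` after `A` and `B` have been merged into `A ∪ B`. -/
noncomputable def mergeMap (A B E : Set N) : Set N := if E = A ∨ E = B then A ∪ B else E

/-- Merge the nodes `A` and `B` into the node `A ∪ B`, which inherits all incoming and all
outgoing edges of `A` and `B`; the edges between `A` and `B` disappear. -/
def merge (K : ClusterGraph N) (A B : Set N) : ClusterGraph N where
  nodes := mergeMap A B '' K.nodes
  Adj C D := C ≠ D ∧ ∃ C₀ D₀, K.Adj C₀ D₀ ∧ mergeMap A B C₀ = C ∧ mergeMap A B D₀ = D

/-- The graphs that result from `G` by a finite sequence of the two operations: deleting a node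
that does not have two outgoing edges to different nodes, and merging two nodes. -/
inductive Reachable (G : DAG N) : ClusterGraph N → Prop
  | start : Reachable G (ofDAG G)
  | delete {K : ClusterGraph N} {A : Set N} : Reachable G K → A ∈ K.nodes →
      (∀ B C, K.Adj A B → K.Adj A C → B = C) → Reachable G (K.delete A)
  | merge {K : ClusterGraph N} {A B : Set N} : Reachable G K → A ∈ K.nodes → B ∈ K.nodes →
      A ≠ B → Reachable G (K.merge A B)

end ClusterGraph

/-- The DAG `H` is a graphical abstraction of the DAG `G`, where each node `a` of `H` stands for
the cluster `c a` of nodes of `G` that have been merged into it. -/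
def IsGraphicalAbstraction {N : Type u} {N' : Type v} (G : DAG N) (H : DAG N') (c : N' → Set N) :
    Prop :=
  ∃ K : ClusterGraph N, ClusterGraph.Reachable G K ∧ Function.Injective c ∧
    Set.range c = K.nodes ∧ ∀ a b, H.Adj a b ↔ K.Adj (c a) (c b)

/-- The ADMG `H` is a graphical abstraction between ADMGs of the ADMG `L`, where each node `C` of
`H` stands for the cluster `cl C` of nodes of `L`: there are DAGs `L'` and `H'` with finitely many
exogenous nodes, whose latent projections are `L` and `H`, such that `H'` is a graphical
abstraction of `L'`. -/
def IsADMGAbstraction {V : Type u} {W : Type v} (L : ADMG V) (H : ADMG W) (cl : W → Set V) :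
    Prop :=
  ∃ (m n : ℕ) (L' : DAG (V ⊕ Fin m)) (H' : DAG (W ⊕ Fin n)) (c : W ⊕ Fin n → Set (V ⊕ Fin m)),
    L'.HasLatentProjection L ∧ H'.HasLatentProjection H ∧ IsGraphicalAbstraction L' H' c ∧
      ∀ C : W, c (Sum.inl C) = Sum.inl '' cl C

/-! ### Causal Bayesian networks and interventional distributions -/

/-- A finite directed acyclic graph has a topological order. -/
theorem DAG.exists_topological_order {N : Type u} [Finite N] (G : DAG N) :
    ∃ l : List N, l.Nodup ∧ (∀ a, a ∈ l) ∧ l.Pairwise fun a b => ¬ G.Adj b a := by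
  classical
  have := Fintype.ofFinite N
  have hpo : IsPartialOrder N (Relation.ReflTransGen G.Adj) :=
    { refl := fun _ => Relation.ReflTransGen.refl
      trans := fun _ _ _ => Relation.ReflTransGen.trans
      antisymm := fun a b hab hba => by
        rcases Relation.reflTransGen_iff_eq_or_transGen.1 hab with h | h
        · exact h.symm
        · exact absurd (h.trans_left hba) (G.acyclic a) }
  obtain ⟨s, hs, hrs⟩ := extend_partialOrder (Relation.ReflTransGen G.Adj)
  refine ⟨Finset.univ.sort s, Finset.sort_nodup _ _, fun a => by simp, ?_⟩
  refine ((Finset.pairwise_sort Finset.univ s).and (Finset.sort_nodup _ _)).imp ?_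
  rintro a b ⟨hab, hne⟩ hadj
  exact hne (antisymm_of s hab (hrs _ _ (Relation.ReflTransGen.single hadj)))

/-- A topological order of the nodes: a list of all nodes in which parents precede children. -/
noncomputable def DAG.order {N : Type u} [Finite N] (G : DAG N) : List N :=
  G.exists_topological_order.choose

/-- A causal Bayesian network over the DAG `G` with domains `X a`: a Markov kernel
`p(a | pa(a))` for each node `a`. -/
structure CBN {N : Type u} (G : DAG N) (X : N → Type x) [∀ a, MeasurableSpace (X a)] where
  mech : ∀ a, Kernel (∀ b : G.pa a, X b) (X a)
  markov : ∀ a, IsMarkovKernel (mech a)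

namespace CBN

variable {N : Type u} {G : DAG N} {X : N → Type x} [∀ a, MeasurableSpace (X a)]

open Classical in
/-- Sample the value of the node `a` from `p(a | pa(a))`, leaving all other values unchanged. -/
noncomputable def step (M : CBN G X) (a : N) : Kernel (∀ b, X b) (∀ b, X b) :=
  (Kernel.id ×ₖ (M.mech a).comap (fun z (b : G.pa a) => z b) (by fun_prop)).map
    fun q => Function.update q.1 a q.2

/-- Sample the nodes of a list one after the other. -/
noncomputable def run (M : CBN G X) : List N → Kernel (∀ b, X b) (∀ b, X b)
  | [] => Kernel.id
  | a :: l => M.run l ∘ₖ M.step a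

open Classical in
/-- The joint distribution of all variables under the intervention `do(S)` that sets every node
`a ∈ S` to `z a`, i.e. the truncated product `∏_{a ∉ S} p(a | pa(a))`: the nodes outside `S` are
sampled from their mechanisms in topological order. The values `z a` with `a ∉ S` are irrelevant,
because they are overwritten before they are read. -/
noncomputable def doDist [Finite N] (M : CBN G X) (S : Set N) (z : ∀ a, X a) :
    Measure (∀ a, X a) :=
  M.run (G.order.filter fun a => a ∉ S) z

open Classical in
theorem measurable_update_pair (a : N) :
    Measurable fun q : (∀ b, X b) × X a => Function.update q.1 a q.2 := by
  refine measurable_pi_lambda _ fun b => ?_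
  by_cases h : b = a
  · subst h
    simpa using measurable_snd
  · simp only [Function.update_of_ne h]
    fun_prop

instance isMarkovKernel_step (M : CBN G X) (a : N) : IsMarkovKernel (M.step a) := by
  classical
  have := M.markov a
  exact Kernel.IsMarkovKernel.map _ (measurable_update_pair a)

instance isMarkovKernel_run (M : CBN G X) (l : List N) : IsMarkovKernel (M.run l) := by
  induction l with
  | nil => exact inferInstanceAs (IsMarkovKernel Kernel.id)
  | cons a l ih => exact inferInstanceAs (IsMarkovKernel (M.run l ∘ₖ M.step a))

instance isProbabilityMeasure_doDist [Finite N] (M : CBN G X) (S : Set N) (z : ∀ a, X a) :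
    IsProbabilityMeasure (M.doDist S z) := by
  unfold doDist; infer_instance

theorem run_cons (M : CBN G X) (a : N) (l : List N) (z : ∀ a, X a) [DecidableEq N] :
    M.run (a :: l) z = (M.mech a fun b => z b).bind fun t => M.run l (Function.update z a t) := by
  classical
  have := M.markov a
  have hu : Measurable fun t : X a => Function.update z a t := measurable_update z
  have hs : M.step a z = (M.mech a fun b => z b).map fun t => Function.update z a t := by
    rw [step, Kernel.map_apply _ (measurable_update_pair a), Kernel.prod_apply, Kernel.id_apply,
      Measure.dirac_prod, Kernel.comap_apply,
      Measure.map_map (measurable_update_pair a) measurable_prodMk_left]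
    congr! 2
    simp only [Function.comp]
    congr!
  rw [run, Kernel.comp_apply, hs, Measure.bind, Measure.map_map (M.run l).measurable hu]
  rfl

theorem run_congr (M : CBN G X) (l : List N) (hl : l.Pairwise fun a b => ¬ G.Adj b a)
    (z z' : ∀ a, X a) (h : ∀ a, a ∉ l → z a = z' a) : M.run l z = M.run l z' := by
  classical
  induction l generalizing z z' with
  | nil => rw [show z = z' from funext fun a => h a (by simp)]
  | cons a l ih =>
    rw [run_cons, run_cons]
    rw [List.pairwise_cons] at hl
    have : (fun b : G.pa a => z b) = fun b : G.pa a => z' b := by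
      funext b
      refine h _ ?_
      rintro hb
      rcases List.mem_cons.1 hb with hb | hb
      · exact G.acyclic a (Relation.TransGen.single (by have := b.2; rw [hb] at this; exact this))
      · exact hl.1 _ hb b.2
    rw [this]
    congr 1
    funext t
    refine ih hl.2 _ _ fun b hb => ?_
    by_cases hba : b = a
    · subst hba; simp
    · simp [hba, h b (by simp [hba, hb])]

/-- The interventional distribution only depends on the values of the intervened nodes. -/
theorem doDist_congr [Finite N] (M : CBN G X) (S : Set N) (z z' : ∀ a, X a)
    (h : ∀ a ∈ S, z a = z' a) : M.doDist S z = M.doDist S z' := by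
  refine M.run_congr _ ?_ _ _ ?_
  · exact (G.exists_topological_order.choose_spec.2.2).filter _
  · intro a ha
    refine h a ?_
    by_contra hS
    exact ha (List.mem_filter.2 ⟨G.exists_topological_order.choose_spec.2.1 a, by simpa using hS⟩)

end CBN

/-! ### Factorizations over a mixed graph -/

/-- The ingredients of a product `p(U) ∏_C p(C | pa(C), U_C)` over the ADMG `H` with domains
`Z C`: finitely many independent latent variables `i : ι` with domains `Y i` and laws `law i`,
and for each node `C` a set `lat C` of latent variables (this is `U_C`) and a Markov kernel
`p(C | pa(C), U_C)`. -/
structure ADMG.LatentModel {W : Type u} (H : ADMG W) (Z : W → Type x)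
    [∀ C, MeasurableSpace (Z C)] where
  ι : Type v
  [fin : Fintype ι]
  Y : ι → Type w
  [meas : ∀ i, MeasurableSpace (Y i)]
  law : ∀ i, Measure (Y i)
  [prob : ∀ i, IsProbabilityMeasure (law i)]
  lat : W → Set ι
  mech : ∀ C, Kernel ((∀ D : H.pa C, Z D) × (∀ i : lat C, Y i)) (Z C)
  [markov : ∀ C, IsMarkovKernel (mech C)]

namespace ADMG.LatentModel

attribute [instance] fin meas prob markov

variable {W : Type*} {H : ADMG W} {Z : W → Type*} [∀ C, MeasurableSpace (Z C)]

/-- The joint law `p(U)` of the latent variables: they are independent. -/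
noncomputable def latentLaw (F : H.LatentModel Z) : Measure (∀ i, F.Y i) := Measure.pi F.law

/-- For a fixed value `y` of the latent variables, the kernels `p(C | pa(C), U_C = y_C)`. -/
noncomputable def atLatent (F : H.LatentModel Z) (y : ∀ i, F.Y i) : CBN H.toDAG Z where
  mech C := (F.mech C).comap (fun z => (z, fun i : F.lat C => y i)) (by fun_prop)
  markov _ := inferInstance

end ADMG.LatentModel

/-!
Each node of the low-level DAG is absorbed by at most one node of `H`: a deleted node joins its only
child, and is dropped if it has none. Only genuine members of a cluster can have edges leaving the
set of nodes absorbed by it. Sampling the whole absorbed set is therefore a mechanism for the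
cluster that reads only the parent clusters and the latent variables, and all edges out of it come
from nodes that an intervention on the cluster fixes. The nodes absorbed by a latent variable of `H`
are closed under parents, so distinct latent variables absorb independent blocks. It remains to
discard the nodes that are irrelevant to the clusters and to sample the others block by block, since
the order of sampling does not affect the distribution.
-/

open scoped ENNReal

/-- No node of the list `l` has a parent at a later position of `l`. -/
abbrev DAG.IsTopSorted {N : Type u} (G : DAG N) (l : List N) : Prop :=
  l.Pairwise fun a b => ¬ G.Adj b a

namespace DAG

variable {N : Type u} (G : DAG N)

theorem not_adj_self (a : N) : ¬ G.Adj a a := fun h => G.acyclic a (.single h)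

variable {G} in
theorem IsTopSorted.not_adj_head {a b : N} {l : List N} (hl : G.IsTopSorted (a :: l))
    (hb : b ∈ a :: l) : ¬ G.Adj b a := by
  rcases List.mem_cons.1 hb with rfl | hb
  · exact G.not_adj_self b
  · exact (List.pairwise_cons.1 hl).1 b hb

variable [Finite N]

theorem nodup_order : G.order.Nodup := G.exists_topological_order.choose_spec.1

theorem mem_order (a : N) : a ∈ G.order := G.exists_topological_order.choose_spec.2.1 a

theorem isTopSorted_order : G.IsTopSorted G.order := G.exists_topological_order.choose_spec.2.2

end DAG

namespace CBN

variable {N : Type u} {G : DAG N} {X : N → Type x} [∀ a, MeasurableSpace (X a)] (M : CBN G X)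

theorem run_nil (z : ∀ a, X a) : M.run [] z = Measure.dirac z := Kernel.id_apply z

theorem run_append (l l' : List N) (z : ∀ a, X a) :
    M.run (l ++ l') z = (M.run l z).bind (M.run l') := by
  suffices M.run (l ++ l') = M.run l' ∘ₖ M.run l by rw [this, Kernel.comp_apply]
  induction l with
  | nil => exact (Kernel.comp_id _).symm
  | cons a l ih => rw [List.cons_append, run, run, ih, Kernel.comp_assoc]

theorem lintegral_run_cons [DecidableEq N] (a : N) (l : List N) (z : ∀ a, X a)
    {f : (∀ a, X a) → ℝ≥0∞} (hf : Measurable f) :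
    ∫⁻ t, f t ∂M.run (a :: l) z =
      ∫⁻ s, ∫⁻ t, f t ∂M.run l (Function.update z a s) ∂M.mech a (fun b => z b) := by
  rw [run_cons, Measure.lintegral_bind _ hf.aemeasurable]
  exact ((M.run l).measurable.comp (measurable_update z)).aemeasurable

theorem run_cons_apply [DecidableEq N] (a : N) (l : List N) (z : ∀ a, X a)
    {E : Set (∀ a, X a)} (hE : MeasurableSet E) :
    M.run (a :: l) z E = ∫⁻ s, M.run l (Function.update z a s) E ∂M.mech a (fun b => z b) := by
  rw [run_cons, Measure.bind_apply hE]
  exact ((M.run l).measurable.comp (measurable_update z)).aemeasurable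

/-! ### Locality of sampling -/

theorem lintegral_run_congr (l : List N) (z : ∀ a, X a) {f g : (∀ a, X a) → ℝ≥0∞}
    (hf : Measurable f) (hg : Measurable g) (h : ∀ t, (∀ a, a ∉ l → t a = z a) → f t = g t) :
    ∫⁻ t, f t ∂M.run l z = ∫⁻ t, g t ∂M.run l z := by
  classical
  induction l generalizing z with
  | nil =>
    rw [run_nil, lintegral_dirac' _ hf, lintegral_dirac' _ hg]
    exact h z fun _ _ => rfl
  | cons a l ih =>
    rw [lintegral_run_cons _ _ _ _ hf, lintegral_run_cons _ _ _ _ hg]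
    refine lintegral_congr fun s => ih _ fun t ht => h t fun b hb => ?_
    rw [List.mem_cons, not_or] at hb
    rw [ht b hb.2, Function.update_of_ne hb.1]

theorem bind_run_congr {β : Type*} [MeasurableSpace β] (l : List N) (z : ∀ a, X a)
    {f g : (∀ a, X a) → Measure β} (hf : Measurable f) (hg : Measurable g)
    (h : ∀ t, (∀ a, a ∉ l → t a = z a) → f t = g t) :
    (M.run l z).bind f = (M.run l z).bind g := by
  ext B hB
  rw [Measure.bind_apply hB hf.aemeasurable, Measure.bind_apply hB hg.aemeasurable]
  exact M.lintegral_run_congr l z (Measure.measurable_measure.1 hf B hB)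
    (Measure.measurable_measure.1 hg B hB) fun t ht => by rw [h t ht]

theorem run_apply_congr (l : List N) (z : ∀ a, X a) {A B : Set (∀ a, X a)}
    (hA : MeasurableSet A) (hB : MeasurableSet B)
    (h : ∀ t, (∀ a, a ∉ l → t a = z a) → (t ∈ A ↔ t ∈ B)) : M.run l z A = M.run l z B := by
  classical
  rw [← lintegral_indicator_one hA, ← lintegral_indicator_one hB]
  exact M.lintegral_run_congr l z (measurable_one.indicator hA) (measurable_one.indicator hB)
    fun t ht => by simp only [Set.indicator_apply, h t ht, Pi.one_apply]

open Classical in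
theorem run_apply_filter {s : Set N} {l : List N} (hl : G.IsTopSorted l)
    (hs : ∀ a b, b ∈ l → b ∈ s → G.Adj a b → a ∈ s) {z z' : ∀ a, X a}
    (hz : ∀ a ∈ s, a ∉ l → z a = z' a) {E : Set (∀ a, X a)} (hE : MeasurableSet E)
    (hEs : DependsOn (· ∈ E) s) : M.run l z E = M.run (l.filter (· ∈ s)) z' E := by
  induction l generalizing z z' with
  | nil =>
    have hzz' : (z ∈ E) = (z' ∈ E) := hEs fun a ha => hz a ha List.not_mem_nil
    simp only [List.filter_nil, run_nil, Measure.dirac_apply' _ hE, Set.indicator_apply, hzz',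
      Pi.one_apply]
  | cons a l ih =>
    have ih' {t t' : ∀ a, X a} (ht : ∀ b ∈ s, b ∉ l → t b = t' b) :=
      ih hl.of_cons (fun c b hb => hs c b (List.mem_cons_of_mem _ hb)) ht
    by_cases ha : a ∈ s
    · rw [List.filter_cons_of_pos (by simpa using ha), run_cons_apply _ _ _ _ hE,
        run_cons_apply _ _ _ _ hE]
      have hpa : (fun b : G.pa a => z b) = fun b : G.pa a => z' b := funext fun b =>
        hz b (hs b a List.mem_cons_self ha b.2) fun hb => hl.not_adj_head hb b.2
      rw [hpa]
      refine lintegral_congr fun t => ih' fun b hb hbl => ?_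
      rcases eq_or_ne b a with rfl | hba
      · rw [Function.update_self, Function.update_self]
      · rw [Function.update_of_ne hba, Function.update_of_ne hba, hz b hb (by simp [hba, hbl])]
    · have := M.markov a
      have hdrop (t : X a) : M.run l (Function.update z a t) E =
          M.run (l.filter (· ∈ s)) z' E := ih' fun b hb hbl => by
        have hba : b ≠ a := fun h => ha (h ▸ hb)
        rw [Function.update_of_ne hba, hz b hb (by simp [hba, hbl])]
      rw [List.filter_cons_of_neg (by simpa using ha), run_cons_apply _ _ _ _ hE,
        lintegral_congr hdrop, lintegral_const, measure_univ, mul_one]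

theorem run_apply_congr_start {l : List N} (hl : G.IsTopSorted l) {z z' : ∀ a, X a}
    (hz : ∀ a b, b ∈ l → G.Adj a b → a ∉ l → z a = z' a) {E : Set (∀ a, X a)}
    (hE : MeasurableSet E) (hEl : DependsOn (· ∈ E) {a | a ∈ l}) :
    M.run l z E = M.run l z' E := by
  let s : Set N := {a | a ∈ l ∨ ∃ b ∈ l, G.Adj a b}
  have hls : ∀ a ∈ l, a ∈ s := fun a ha => Or.inl ha
  have hz' : ∀ a ∈ s, a ∉ l → z a = z' a := fun a ha hal =>
    have ⟨b, hb, hab⟩ := ha.resolve_left hal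
    hz a b hb hab hal
  have hclosed : ∀ a b, b ∈ l → b ∈ s → G.Adj a b → a ∈ s := fun a b hb _ hab =>
    Or.inr ⟨b, hb, hab⟩
  refine (M.run_apply_filter hl hclosed hz' hE (hEl.mono hls)).trans ?_
  rw [List.filter_eq_self.2]
  simpa only [decide_eq_true_eq] using hls

theorem map_run_congr_start {β : Type*} [MeasurableSpace β] {l : List N} (hl : G.IsTopSorted l)
    {z z' : ∀ a, X a} (hz : ∀ a b, b ∈ l → G.Adj a b → a ∉ l → z a = z' a)
    {g : (∀ a, X a) → β} (hg : Measurable g) (hgl : DependsOn g {a | a ∈ l}) :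
    (M.run l z).map g = (M.run l z').map g := by
  ext B hB
  rw [Measure.map_apply hg hB, Measure.map_apply hg hB]
  exact M.run_apply_congr_start hl hz (hg hB) fun x y hxy => by
    simp only [Set.mem_preimage, hgl hxy]

theorem run_append_apply_inter {l l' : List N} (hl' : G.IsTopSorted l') (hdisj : l.Disjoint l')
    (hadj : ∀ a ∈ l, ∀ b ∈ l', ¬ G.Adj a b) (z : ∀ a, X a) {A B : Set (∀ a, X a)}
    (hA : MeasurableSet A) (hB : MeasurableSet B) (hAl : DependsOn (· ∈ A) {a | a ∈ l})
    (hBl' : DependsOn (· ∈ B) {a | a ∈ l'}) :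
    M.run (l ++ l') z (A ∩ B) = M.run l z A * M.run l' z B := by
  have hinter (t : ∀ a, X a) (ht : ∀ a, a ∉ l → t a = z a) :
      M.run l' t (A ∩ B) = A.indicator (fun _ => M.run l' z B) t := by
    have hstart : M.run l' t B = M.run l' z B :=
      M.run_apply_congr_start hl' (fun a b hb hab _ => ht a fun ha => hadj a ha b hb hab) hB hBl'
    by_cases htA : t ∈ A
    · rw [Set.indicator_of_mem htA, ← hstart]
      refine M.run_apply_congr l' t (hA.inter hB) hB fun r hr => and_iff_right ?_
      exact (hAl fun a ha => hr a (hdisj ha)).mpr htA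
    · rw [Set.indicator_of_notMem htA, ← measure_empty (μ := M.run l' t)]
      refine M.run_apply_congr l' t (hA.inter hB) .empty fun r hr => iff_false_intro fun h => htA ?_
      exact (hAl fun a ha => hr a (hdisj ha)).mp h.1
  rw [run_append, Measure.bind_apply (hA.inter hB) (M.run l').measurable.aemeasurable,
    M.lintegral_run_congr l z ((M.run l').measurable_coe (hA.inter hB))
      (measurable_const.indicator hA) hinter, lintegral_indicator_const hA, mul_comm]

/-! ### Independence of the sampling order -/

theorem run_swap {a b : N} (hne : a ≠ b) (hab : ¬ G.Adj a b) (hba : ¬ G.Adj b a) (l : List N) :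
    M.run (a :: b :: l) = M.run (b :: a :: l) := by
  classical
  have := M.markov
  have hupdate {c d : N} (hcd : ¬ G.Adj c d) (z : ∀ a, X a) (s : X c) :
      (fun e : G.pa d => Function.update z c s e) = fun e : G.pa d => z e :=
    funext fun e => Function.update_of_ne (fun h : ↑e = c => hcd (h ▸ e.2)) s z
  ext z E hE
  have hjoint : Measurable fun q : X a × X b =>
      M.run l (Function.update (Function.update z a q.1) b q.2) E :=
    ((M.run l).measurable_coe hE).comp
      (measurable_update'.comp (((measurable_update z).comp measurable_fst).prodMk measurable_snd))
  simp_rw [run_cons_apply _ _ _ _ hE, hupdate hab, hupdate hba]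
  rw [lintegral_lintegral_swap hjoint.aemeasurable]
  simp_rw [Function.update_comm hne]

theorem run_move_front {a : N} {l : List N}
    (h : ∀ b ∈ l, a ≠ b ∧ ¬ G.Adj a b ∧ ¬ G.Adj b a) (l' : List N) :
    M.run (l ++ a :: l') = M.run (a :: (l ++ l')) := by
  induction l with
  | nil => rfl
  | cons b l ih =>
    obtain ⟨hne, hab, hba⟩ := h b List.mem_cons_self
    rw [List.cons_append, List.cons_append, run_swap M hne hab hba, run, ih, ← run]
    exact fun c hc => h c (List.mem_cons_of_mem _ hc)

theorem run_eq_of_perm {l l' : List N} (hperm : l.Perm l') (hnd : l.Nodup)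
    (hl : G.IsTopSorted l) (hl' : G.IsTopSorted l') : M.run l = M.run l' := by
  induction l' generalizing l with
  | nil => rw [hperm.eq_nil]
  | cons a l' ih =>
    obtain ⟨l₁, l₂, rfl⟩ := List.append_of_mem (hperm.mem_iff.2 List.mem_cons_self)
    have hp : (l₁ ++ l₂).Perm l' := (List.perm_middle.symm.trans hperm).cons_inv
    have hsub : (l₁ ++ l₂).Sublist (l₁ ++ a :: l₂) :=
      (List.Sublist.refl _).append (List.sublist_cons_self _ _)
    have hfront : ∀ b ∈ l₁, a ≠ b ∧ ¬ G.Adj a b ∧ ¬ G.Adj b a := fun b hb =>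
      ⟨fun h => (List.nodup_append.1 hnd).2.2 b hb a List.mem_cons_self h.symm,
        (List.pairwise_append.1 hl).2.2 b hb a List.mem_cons_self,
        hl'.not_adj_head (List.mem_cons_of_mem _ (hp.mem_iff.1 (List.mem_append_left _ hb)))⟩
    rw [M.run_move_front hfront, run, ih hp (hnd.sublist hsub) (hl.sublist hsub) hl'.of_cons, run]

theorem nonempty_states [Finite N] (M : CBN G X) : Nonempty (∀ a, X a) := by
  have := M.markov
  have : Std.Irrefl (Relation.TransGen G.Adj) := ⟨G.acyclic⟩
  have hwf := Finite.wellFounded_of_trans_of_irrefl (Relation.TransGen G.Adj)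
  refine ⟨fun a => Nonempty.some ?_⟩
  induction a using hwf.induction with
  | _ a ih => exact (M.mech a fun b => (ih b (.single b.2)).some).nonempty_of_neZero

end CBN

/-! ### Networks over clusters -/

theorem measure_bind_map {α β γ : Type*} [MeasurableSpace α] [MeasurableSpace β]
    [MeasurableSpace γ] (μ : Measure α) {g : α → β} (hg : Measurable g) {f : β → Measure γ}
    (hf : Measurable f) : (μ.map g).bind f = μ.bind (f ∘ g) := by
  rw [Measure.bind, Measure.map_map hf hg, Measure.bind]

open Classical in
/-- The state `z` with the values `q` written to the nodes `s k`. -/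
noncomputable def overwrite {κ : Type*} {N : Type u} {X : N → Type x} (s : κ → N) (z : ∀ a, X a)
    (q : ∀ k, X (s k)) : ∀ a, X a :=
  fun a => if h : ∃ k, s k = a then h.choose_spec ▸ q h.choose else z a

section Overwrite

variable {κ : Type*} {N : Type u} {X : N → Type x} {s : κ → N}

theorem overwrite_of_mem_range (z x : ∀ a, X a) {a : N} (ha : a ∈ Set.range s) :
    overwrite s z (fun k => x (s k)) a = x a := by
  have hcast : ∀ k (hk : s k = a), hk ▸ x (s k) = x a := by rintro k rfl; rfl
  rw [overwrite, dif_pos (show ∃ k, s k = a from ha)]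
  exact hcast _ _

theorem measurable_overwrite [∀ a, MeasurableSpace (X a)] (z : ∀ a, X a) :
    Measurable (overwrite s z) := by
  refine measurable_pi_lambda _ fun a => ?_
  by_cases h : ∃ k, s k = a
  · have hcast : ∀ k (hk : s k = a), Measurable fun q : ∀ k, X (s k) => hk ▸ q k := by
      rintro k rfl
      exact measurable_pi_apply k
    simpa only [overwrite, dif_pos h] using hcast _ h.choose_spec
  · simpa only [overwrite, dif_neg h] using measurable_const

end Overwrite

theorem ADMG.LatentModel.measurable_run_atLatent {W : Type*} {H : ADMG W} {Z : W → Type*}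
    [∀ C, MeasurableSpace (Z C)] (F : H.LatentModel Z) (l : List W) :
    Measurable fun p : (∀ i, F.Y i) × (∀ C, Z C) => (F.atLatent p.1).run l p.2 := by
  classical
  induction l with
  | nil => exact Kernel.id.measurable.comp measurable_snd
  | cons C l ih =>
    let κ : Kernel ((∀ i, F.Y i) × (∀ C, Z C)) (Z C) :=
      (F.mech C).comap (fun p => (fun D : H.pa C => p.2 D, fun i : F.lat C => p.1 i)) (by fun_prop)
    have hupdate : Measurable fun q : ((∀ i, F.Y i) × (∀ C, Z C)) × Z C =>
        (q.1.1, Function.update q.1.2 C q.2) :=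
      (measurable_fst.comp measurable_fst).prodMk
        (measurable_update'.comp ((measurable_snd.comp measurable_fst).prodMk measurable_snd))
    refine Measure.measurable_of_measurable_coe _ fun B hB => ?_
    simp_rw [CBN.run_cons_apply _ C l _ hB]
    exact Measurable.lintegral_kernel_prod_right (κ := κ)
      ((Measure.measurable_coe hB).comp (ih.comp hupdate))

/-- An assignment of nodes of `G` to the clusters `C : W` and to the blocks of latent variables
`i : ι` from which they are sampled, where `lat C` is the set of blocks that `C` may read and `e`
embeds the members of the clusters into the nodes of `G`. A node of role `none` is irrelevant to the
clusters. Members of `cl C` have the role `C`, but further nodes may have this role: they are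
sampled along with `C` without being read by other clusters. -/
structure ClusterRoles {N : Type u} {V : Type v} {W : Type w} (G : DAG N) (H : ADMG W) (e : V → N)
    (cl : W → Set V) (ι : Type*) where
  role : N → Option (W ⊕ ι)
  lat : W → Set ι
  role_of_mem : ∀ {C a}, a ∈ cl C → role (e a) = some (Sum.inl C)
  latent_of_adj : ∀ {a b i}, G.Adj a b → role b = some (Sum.inr i) → role a = some (Sum.inr i)
  mem_lat_of_adj : ∀ {a b i C}, G.Adj a b → role a = some (Sum.inr i) →
    role b = some (Sum.inl C) → i ∈ lat C
  eq_or_mem_of_adj : ∀ {a b C D}, G.Adj a b → role a = some (Sum.inl C) →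
    role b = some (Sum.inl D) → C = D ∨ a ∈ e '' cl C ∧ H.Adj C D
  none_of_adj : ∀ {a b}, G.Adj a b → role a = none → role b = none

namespace ClusterRoles

variable {N : Type u} {V : Type v} {W : Type w} {G : DAG N} {H : ADMG W} {e : V → N}
  {cl : W → Set V} {ι : Type*} (R : ClusterRoles G H e cl ι) {X : N → Type x}

/-- The nodes of the block `i` of latent variables. -/
abbrev Block (i : ι) : Type u := {a // R.role a = some (Sum.inr i)}

/-- The values of the blocks of latent variables. -/
def latentState (z : ∀ a, X a) (i : ι) (a : R.Block i) : X a := z a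

/-- The values of the clusters. -/
def clusterState (e : V → N) (cl : W → Set V) (z : ∀ a, X a) (C : W) (a : cl C) : X (e a) := z (e a)

/-- A state in which the parents of the cluster `C` and its latent variables have the values `q`
and all other nodes have the values `z₀`. -/
noncomputable def parentState (z₀ : ∀ a, X a) (C : W)
    (q : (∀ D : H.pa C, ∀ a : cl D, X (e a)) × (∀ i : R.lat C, ∀ a : R.Block i, X a)) :
    ∀ a, X a :=
  overwrite (Sum.elim (fun p : Σ D : H.pa C, cl D => e p.2)
    fun p : Σ i : R.lat C, R.Block i => (p.2 : N)) z₀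
    (Sum.rec (fun p => q.1 p.1 p.2) fun p => q.2 p.1 p.2)

theorem parentState_of_adj (z₀ x : ∀ a, X a) {C : W} {a b : N} (hab : G.Adj a b)
    (hb : R.role b = some (Sum.inl C)) (ha : R.role a ≠ some (Sum.inl C)) :
    R.parentState z₀ C (fun D => clusterState e cl x D, fun i => R.latentState x i) a = x a := by
  let s := Sum.elim (fun p : Σ D : H.pa C, cl D => e p.2)
    fun p : Σ i : R.lat C, R.Block i => (p.2 : N)
  have hq : R.parentState z₀ C (fun D => clusterState e cl x D, fun i => R.latentState x i) =
      overwrite s z₀ fun k => x (s k) := by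
    rw [parentState]
    congr 1
    funext k
    rcases k with k | k <;> rfl
  rw [hq, overwrite_of_mem_range]
  rcases hr : R.role a with _ | D | i
  · simp [R.none_of_adj hab hr] at hb
  · rcases R.eq_or_mem_of_adj hab hr hb with rfl | ⟨⟨a, haD, rfl⟩, hD⟩
    · exact absurd hr ha
    · exact ⟨Sum.inl ⟨⟨D, hD⟩, a, haD⟩, rfl⟩
  · exact ⟨Sum.inr ⟨⟨i, R.mem_lat_of_adj hab hr hb⟩, a, hr⟩, rfl⟩

/-- The nodes that are read when the clusters outside `S` are sampled under the intervention on the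
clusters in `S`. -/
def relevant (S : Set W) : Set N :=
  {a | (∃ i, R.role a = some (Sum.inr i)) ∨ (∃ C ∉ S, R.role a = some (Sum.inl C)) ∨
    a ∈ ⋃ C ∈ S, e '' cl C}

theorem exists_role_of_mem_iUnion {S : Set W} {a : N} (ha : a ∈ ⋃ C ∈ S, e '' cl C) :
    ∃ C ∈ S, R.role a = some (Sum.inl C) := by
  obtain ⟨C, hC, a, haC, rfl⟩ := Set.mem_iUnion₂.1 ha
  exact ⟨C, hC, R.role_of_mem haC⟩

theorem mem_relevant_of_adj {S : Set W} {a b : N} (hab : G.Adj a b) (hb : b ∈ R.relevant S)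
    (hbS : b ∉ ⋃ C ∈ S, e '' cl C) : a ∈ R.relevant S := by
  rcases hb with ⟨i, hi⟩ | ⟨C, hC, hbC⟩ | hb
  · exact Or.inl ⟨i, R.latent_of_adj hab hi⟩
  · rcases hr : R.role a with _ | D | i
    · simp [R.none_of_adj hab hr] at hbC
    · by_cases hD : D ∈ S
      · rcases R.eq_or_mem_of_adj hab hr hbC with rfl | ⟨haD, -⟩
        · exact absurd hD hC
        · exact Or.inr (Or.inr (Set.mem_biUnion hD haD))
      · exact Or.inr (Or.inl ⟨D, hD, hr⟩)
    · exact Or.inl ⟨i, hr⟩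
  · exact absurd hb hbS

section NodesOf

variable [Finite N]

open Classical in
/-- The nodes of role `r` in topological order. -/
noncomputable def nodesOf (r : W ⊕ ι) : List N := G.order.filter fun a => R.role a = some r

theorem mem_nodesOf {r : W ⊕ ι} {a : N} : a ∈ R.nodesOf r ↔ R.role a = some r := by
  simp [nodesOf, G.mem_order]

theorem mem_flatMap_latents {k : List ι} {a : N} :
    a ∈ (k.map Sum.inr).flatMap R.nodesOf ↔ ∃ i ∈ k, R.role a = some (Sum.inr i) := by
  simp [mem_nodesOf]

theorem mem_flatMap_clusters {l : List W} {a : N} :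
    a ∈ (l.map Sum.inl).flatMap R.nodesOf ↔ ∃ C ∈ l, R.role a = some (Sum.inl C) := by
  simp [mem_nodesOf]

theorem disjoint_nodesOf_flatMap_latents {i : ι} {k : List ι} (hik : i ∉ k) :
    (R.nodesOf (Sum.inr i)).Disjoint ((k.map Sum.inr).flatMap R.nodesOf) := fun a ha hak => by
  obtain ⟨j, hj, har⟩ := R.mem_flatMap_latents.1 hak
  obtain rfl : i = j := by simpa using (R.mem_nodesOf.1 ha).symm.trans har
  exact hik hj

theorem isTopSorted_nodesOf (r : W ⊕ ι) : G.IsTopSorted (R.nodesOf r) :=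
  G.isTopSorted_order.filter _

theorem nodup_flatMap_nodesOf {rs : List (W ⊕ ι)} (hrs : rs.Nodup) :
    (rs.flatMap R.nodesOf).Nodup := by
  refine List.nodup_flatMap.2 ⟨fun r _ => G.nodup_order.filter _, hrs.imp fun h a ha hb => h ?_⟩
  exact Option.some.inj ((R.mem_nodesOf.1 ha).symm.trans (R.mem_nodesOf.1 hb))

theorem isTopSorted_flatMap_nodesOf {rs : List (W ⊕ ι)}
    (hrs : rs.Pairwise fun r s => ∀ a b, G.Adj a b → R.role b = some r → R.role a ≠ some s) :
    G.IsTopSorted (rs.flatMap R.nodesOf) :=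
  List.pairwise_flatMap.2 ⟨fun r _ => R.isTopSorted_nodesOf r, hrs.imp fun h a ha b hb hab =>
    h b a hab (R.mem_nodesOf.1 ha) (R.mem_nodesOf.1 hb)⟩

theorem isTopSorted_latents {k : List ι} (hk : k.Nodup) :
    G.IsTopSorted ((k.map Sum.inr).flatMap R.nodesOf) := by
  refine R.isTopSorted_flatMap_nodesOf (List.pairwise_map.2 (hk.imp ?_))
  intro i j hij a b hab hb ha
  exact hij (by simpa using (R.latent_of_adj hab hb).symm.trans ha)

theorem isTopSorted_latents_append_clusters {k : List ι} (hk : k.Nodup) {l : List W}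
    (hl : l.Nodup) (hlH : H.IsTopSorted l) :
    G.IsTopSorted ((k.map Sum.inr ++ l.map Sum.inl).flatMap R.nodesOf) := by
  rw [List.flatMap_append]
  refine List.pairwise_append.2 ⟨R.isTopSorted_latents hk,
    R.isTopSorted_flatMap_nodesOf (List.pairwise_map.2 ((hl.and hlH).imp ?_)), ?_⟩
  · rintro C D ⟨hCD, hDC⟩ a b hab hb ha
    rcases R.eq_or_mem_of_adj hab ha hb with h | h
    · exact hCD h.symm
    · exact hDC h.2
  · intro a ha b hb hba
    obtain ⟨i, -, ha⟩ := R.mem_flatMap_latents.1 ha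
    obtain ⟨C, -, hb⟩ := R.mem_flatMap_clusters.1 hb
    simp [R.latent_of_adj hba ha] at hb

end NodesOf

variable [∀ a, MeasurableSpace (X a)]

theorem measurable_latentState : Measurable (R.latentState (X := X)) :=
  measurable_pi_lambda _ fun _ => measurable_pi_lambda _ fun a => measurable_pi_apply (a : N)

theorem measurable_latentState_apply (i : ι) :
    Measurable fun z : ∀ a, X a => R.latentState z i :=
  (measurable_pi_apply i).comp R.measurable_latentState

theorem measurable_clusterState : Measurable (clusterState (X := X) e cl) :=
  measurable_pi_lambda _ fun _ => measurable_pi_lambda _ fun a => measurable_pi_apply (e a)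

theorem measurable_clusterState_apply (C : W) :
    Measurable fun z : ∀ a, X a => clusterState e cl z C :=
  (measurable_pi_apply C).comp measurable_clusterState

theorem measurable_parentState (z₀ : ∀ a, X a) (C : W) : Measurable (R.parentState z₀ C) := by
  refine (measurable_overwrite z₀).comp (measurable_pi_lambda _ ?_)
  rintro (p | p)
  · exact (measurable_pi_apply p.2).comp ((measurable_pi_apply p.1).comp measurable_fst)
  · exact (measurable_pi_apply p.2).comp ((measurable_pi_apply p.1).comp measurable_snd)

variable [Finite N] (M : CBN G X)

theorem map_latentState_run_block (z z' : ∀ a, X a) (i : ι) :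
    (M.run (R.nodesOf (Sum.inr i)) z).map (R.latentState · i) =
      (M.run (R.nodesOf (Sum.inr i)) z').map (R.latentState · i) := by
  refine M.map_run_congr_start (R.isTopSorted_nodesOf _) (fun a b hb hab ha => absurd ?_ ha)
    (R.measurable_latentState_apply i) fun x y hxy => funext fun a => hxy a (R.mem_nodesOf.2 a.2)
  exact R.mem_nodesOf.2 (R.latent_of_adj hab (R.mem_nodesOf.1 hb))

/-- The joint law of the block `i` of latent variables. The start `z₀` of the sampling process is
irrelevant, because every ancestor of the block belongs to it. -/
noncomputable def blockLaw (z₀ : ∀ a, X a) (i : ι) : Measure (∀ a : R.Block i, X a) :=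
  (M.run (R.nodesOf (Sum.inr i)) z₀).map (R.latentState · i)

instance isProbabilityMeasure_blockLaw (z₀ : ∀ a, X a) (i : ι) :
    IsProbabilityMeasure (R.blockLaw M z₀ i) :=
  Measure.isProbabilityMeasure_map (R.measurable_latentState_apply i).aemeasurable

/-- The latent variables are the blocks, and each cluster is sampled along with the other nodes
that have its role. -/
noncomputable def latentModel [Fintype ι] (z₀ : ∀ a, X a) :
    H.LatentModel (fun C => ∀ a : cl C, X (e a)) where
  ι := ι
  Y i := ∀ a : R.Block i, X a
  law := R.blockLaw M z₀
  lat := R.lat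
  mech C := ((M.run (R.nodesOf (Sum.inl C))).comap (R.parentState z₀ C)
    (R.measurable_parentState z₀ C)).map (clusterState e cl · C)
  markov C := Kernel.IsMarkovKernel.map _ (measurable_clusterState_apply C)

variable (z₀ : ∀ a, X a)

theorem run_latents_apply {k : List ι} (hk : k.Nodup) (z : ∀ a, X a)
    {s : ∀ i, Set (∀ a : R.Block i, X a)} (hs : ∀ i, MeasurableSet (s i)) :
    M.run ((k.map Sum.inr).flatMap R.nodesOf) z (R.latentState ⁻¹' Set.pi {i | i ∈ k} s) =
      (k.map fun i => R.blockLaw M z₀ i (s i)).prod := by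
  induction k with
  | nil => simp
  | cons i k ih =>
    obtain ⟨hik, hk⟩ := List.nodup_cons.1 hk
    have hA : MeasurableSet ((R.latentState · i) ⁻¹' s i) :=
      R.measurable_latentState_apply i (hs i)
    have hB : MeasurableSet (R.latentState ⁻¹' Set.pi {j | j ∈ k} s) :=
      R.measurable_latentState (.pi k.finite_toSet.countable fun j _ => hs j)
    have hinter : R.latentState ⁻¹' Set.pi {j | j ∈ i :: k} s =
        (R.latentState · i) ⁻¹' s i ∩ R.latentState ⁻¹' Set.pi {j | j ∈ k} s := by
      ext
      simp [Set.mem_pi]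
    have hdisj := R.disjoint_nodesOf_flatMap_latents hik
    rw [List.map_cons, List.flatMap_cons, hinter, M.run_append_apply_inter
      (R.isTopSorted_latents hk) hdisj ?_ z hA hB ?_ ?_, ih hk, List.map_cons, List.prod_cons,
      blockLaw, R.map_latentState_run_block M z₀ z i,
      Measure.map_apply (R.measurable_latentState_apply i) (hs i)]
    · intro a ha b hb hab
      obtain ⟨j, hj, hbj⟩ := R.mem_flatMap_latents.1 hb
      exact hdisj ha (R.mem_flatMap_latents.2 ⟨j, hj, R.latent_of_adj hab hbj⟩)
    · intro x y hxy
      have heq : R.latentState x i = R.latentState y i :=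
        funext fun a => hxy a (R.mem_nodesOf.2 a.2)
      simp only [Set.mem_preimage, heq]
    · intro x y hxy
      have heq (j) (hj : j ∈ k) : R.latentState x j = R.latentState y j :=
        funext fun a => hxy a (R.mem_flatMap_latents.2 ⟨j, hj, a.2⟩)
      simp +contextual only [Set.mem_preimage, Set.mem_pi, Set.mem_ofPred_eq, heq]

variable [Fintype ι]

/-- The nodes of all blocks of latent variables, block after block. -/
noncomputable def latentNodes : List N := (Finset.univ.toList.map Sum.inr).flatMap R.nodesOf

theorem mem_latentNodes {a : N} : a ∈ R.latentNodes ↔ ∃ i, R.role a = some (Sum.inr i) := by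
  simp only [latentNodes, mem_flatMap_latents, Finset.mem_toList, Finset.mem_univ, true_and]

theorem map_latentState_run (z : ∀ a, X a) :
    (M.run R.latentNodes z).map R.latentState = (R.latentModel M z₀).latentLaw := by
  refine (Measure.pi_eq (μ := R.blockLaw M z₀) fun s hs => ?_).symm
  rw [Measure.map_apply R.measurable_latentState (MeasurableSet.univ_pi hs),
    ← Finset.prod_map_toList, ← R.run_latents_apply M z₀ (Finset.nodup_toList _) z hs]
  simp only [latentNodes, Finset.mem_toList, Finset.mem_univ, Set.ofPred_true]

theorem mech_atLatent (C : W) (x : ∀ a, X a) :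
    ((R.latentModel M z₀).atLatent (R.latentState x)).mech C (fun D => clusterState e cl x D) =
      (M.run (R.nodesOf (Sum.inl C)) x).map (clusterState e cl · C) := by
  have hmech : ((R.latentModel M z₀).atLatent (R.latentState x)).mech C
      (fun D => clusterState e cl x D) = (M.run (R.nodesOf (Sum.inl C)) (R.parentState z₀ C
        (fun D => clusterState e cl x D, fun i => R.latentState x i))).map
          (clusterState e cl · C) :=
    Kernel.map_apply _ (measurable_clusterState_apply C) _
  rw [hmech]
  refine M.map_run_congr_start (R.isTopSorted_nodesOf _) (fun a b hb hab ha => ?_)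
    (measurable_clusterState_apply C) fun x y hxy => funext fun a => ?_
  · rw [mem_nodesOf] at ha hb
    exact R.parentState_of_adj z₀ x hab hb ha
  · exact hxy (e a) (R.mem_nodesOf.2 (R.role_of_mem a.2))

theorem map_clusterState_run (l : List W) (x : ∀ a, X a) :
    (M.run ((l.map Sum.inl).flatMap R.nodesOf) x).map (clusterState e cl) =
      ((R.latentModel M z₀).atLatent (R.latentState x)).run l (clusterState e cl x) := by
  classical
  induction l generalizing x with
  | nil =>
    rw [List.map_nil, List.flatMap_nil, CBN.run_nil, CBN.run_nil,
      Measure.map_dirac' measurable_clusterState]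
  | cons C l ih =>
    let F := (R.latentModel M z₀).atLatent (R.latentState x)
    have hF : Measurable fun t => F.run l (Function.update (clusterState e cl x) C t) :=
      (F.run l).measurable.comp (measurable_update _)
    rw [List.map_cons, List.flatMap_cons, CBN.run_append, CBN.run_cons, R.mech_atLatent,
      measure_bind_map _ (measurable_clusterState_apply C) hF,
      Measure.map_comp _ _ measurable_clusterState]
    refine M.bind_run_congr _ _ (Kernel.measurable _)
      (hF.comp (measurable_clusterState_apply C)) fun t ht => ?_
    have hlatent : R.latentState t = R.latentState x := funext fun i => funext fun a =>
      ht a fun ha => by simpa [a.2] using R.mem_nodesOf.1 ha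
    have hcluster : clusterState e cl t =
        Function.update (clusterState e cl x) C (clusterState e cl t C) := by
      refine Function.eq_update_iff.2 ⟨rfl, fun D hD => funext fun a => ht (e a) fun ha => hD ?_⟩
      simpa [R.role_of_mem a.2] using R.mem_nodesOf.1 ha
    rw [Kernel.map_apply _ measurable_clusterState, ih, hlatent, hcluster]
    simp only [Function.comp_apply, F]

theorem map_clusterState_run_latents_append (l : List W) (z : ∀ a, X a) :
    (M.run (R.latentNodes ++ (l.map Sum.inl).flatMap R.nodesOf) z).map (clusterState e cl) =
      (R.latentModel M z₀).latentLaw.bind fun y =>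
        ((R.latentModel M z₀).atLatent y).run l (clusterState e cl z) := by
  have hF : Measurable fun y => ((R.latentModel M z₀).atLatent y).run l (clusterState e cl z) :=
    ((R.latentModel M z₀).measurable_run_atLatent l).comp (measurable_id.prodMk measurable_const)
  rw [CBN.run_append, Measure.map_comp _ _ measurable_clusterState,
    ← R.map_latentState_run M z₀ z]
  refine Eq.trans ?_ (measure_bind_map _ R.measurable_latentState hF).symm
  refine M.bind_run_congr _ _ (Kernel.measurable _) (hF.comp R.measurable_latentState)
    fun t ht => ?_
  have hcluster : clusterState e cl t = clusterState e cl z := funext fun C => funext fun a =>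
    ht (e a) fun ha => by
      obtain ⟨i, hi⟩ := R.mem_latentNodes.1 ha
      simp [R.role_of_mem a.2] at hi
  rw [Kernel.map_apply _ measurable_clusterState, R.map_clusterState_run M z₀, hcluster]
  rfl

variable [Finite W]

open Classical in
theorem perm_filter_relevant (S : Set W) :
    ((G.order.filter fun a => a ∉ ⋃ C ∈ S, e '' cl C).filter (· ∈ R.relevant S)).Perm
      (R.latentNodes ++ ((H.order.filter fun C => C ∉ S).map Sum.inl).flatMap R.nodesOf) := by
  have hnd : (R.latentNodes ++
      ((H.order.filter fun C => C ∉ S).map Sum.inl).flatMap R.nodesOf).Nodup := by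
    rw [latentNodes, ← List.flatMap_append]
    exact R.nodup_flatMap_nodesOf (List.nodup_append.2
      ⟨(Finset.nodup_toList _).map Sum.inr_injective,
        (H.nodup_order.filter _).map Sum.inl_injective, by simp⟩)
  refine (List.perm_ext_iff_of_nodup ((G.nodup_order.filter _).filter _) hnd).2 fun a => ?_
  simp only [List.mem_filter, List.mem_append, mem_latentNodes, mem_flatMap_clusters, G.mem_order,
    H.mem_order, true_and, decide_eq_true_eq]
  constructor
  · rintro ⟨haS, hi | hC | ha⟩
    · exact Or.inl hi
    · exact Or.inr hC
    · exact absurd ha haS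
  · rintro (⟨i, hi⟩ | ⟨C, hC, haC⟩)
    · refine ⟨fun ha => ?_, Or.inl ⟨i, hi⟩⟩
      obtain ⟨C, -, haC⟩ := R.exists_role_of_mem_iUnion ha
      simp [hi] at haC
    · refine ⟨fun ha => ?_, Or.inr (Or.inl ⟨C, hC, haC⟩)⟩
      obtain ⟨D, hD, haD⟩ := R.exists_role_of_mem_iUnion ha
      obtain rfl : C = D := by simpa using haC.symm.trans haD
      exact hC hD

theorem map_clusterState_doDist_apply (S : Set W) (z : ∀ a, X a)
    {E : Set (∀ C, ∀ a : cl C, X (e a))} (hE : MeasurableSet E) (hES : DependsOn (· ∈ E) Sᶜ) :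
    (M.doDist (⋃ C ∈ S, e '' cl C) z).map (clusterState e cl) E =
      ∫⁻ y, ((R.latentModel M z₀).atLatent y).doDist S (clusterState e cl z) E
        ∂(R.latentModel M z₀).latentLaw := by
  classical
  let l : List W := H.order.filter fun C => C ∉ S
  have hsorted : G.IsTopSorted (R.latentNodes ++ (l.map Sum.inl).flatMap R.nodesOf) := by
    rw [latentNodes, ← List.flatMap_append]
    exact R.isTopSorted_latents_append_clusters (Finset.nodup_toList _) (H.nodup_order.filter _)
      (H.isTopSorted_order.filter _)
  have hdep : DependsOn (· ∈ clusterState e cl ⁻¹' E) (R.relevant S) := fun x y hxy =>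
    hES fun C hC => funext fun a => hxy _ (Or.inr (Or.inl ⟨C, hC, R.role_of_mem a.2⟩))
  have hF : Measurable fun y => ((R.latentModel M z₀).atLatent y).run l (clusterState e cl z) :=
    ((R.latentModel M z₀).measurable_run_atLatent l).comp (measurable_id.prodMk measurable_const)
  calc (M.doDist (⋃ C ∈ S, e '' cl C) z).map (clusterState e cl) E
      = M.run ((G.order.filter fun a => a ∉ ⋃ C ∈ S, e '' cl C).filter (· ∈ R.relevant S)) z
          (clusterState e cl ⁻¹' E) := by
        rw [Measure.map_apply measurable_clusterState hE]
        exact M.run_apply_filter (G.isTopSorted_order.filter _)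
          (fun a b hb hbS hab => R.mem_relevant_of_adj hab hbS (by simpa [G.mem_order] using hb))
          (fun _ _ _ => rfl) (measurable_clusterState hE) hdep
    _ = (M.run (R.latentNodes ++ (l.map Sum.inl).flatMap R.nodesOf) z).map
          (clusterState e cl) E := by
        rw [Measure.map_apply measurable_clusterState hE, M.run_eq_of_perm
          (R.perm_filter_relevant S) ((G.nodup_order.filter _).filter _)
          ((G.isTopSorted_order.filter _).filter _) hsorted]
    _ = ∫⁻ y, ((R.latentModel M z₀).atLatent y).doDist S (clusterState e cl z) E
          ∂(R.latentModel M z₀).latentLaw := by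
        rw [R.map_clusterState_run_latents_append M z₀, Measure.bind_apply hE hF.aemeasurable]
        rfl

theorem map_doDist_apply (S : Set W) (z : ∀ a, X a)
    {E : Set (∀ C : (Sᶜ : Set W), ∀ a : cl C, X (e a))} (hE : MeasurableSet E) :
    (M.doDist (⋃ C ∈ S, e '' cl C) z).map
        (fun y (C : (Sᶜ : Set W)) (a : cl C) => y (e a)) E =
      ∫⁻ y, (((R.latentModel M z₀).atLatent y).doDist S fun _ a => z (e a)).map
        (fun t (C : (Sᶜ : Set W)) => t C) E ∂(R.latentModel M z₀).latentLaw := by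
  let restrict (t : ∀ C, ∀ a : cl C, X (e a)) (C : (Sᶜ : Set W)) : ∀ a : cl C, X (e a) := t C
  have hrestrict : Measurable restrict := by fun_prop
  calc (M.doDist (⋃ C ∈ S, e '' cl C) z).map (restrict ∘ clusterState e cl) E
      = (M.doDist (⋃ C ∈ S, e '' cl C) z).map (clusterState e cl) (restrict ⁻¹' E) := by
        rw [← Measure.map_map hrestrict measurable_clusterState, Measure.map_apply hrestrict hE]
    _ = ∫⁻ y, ((R.latentModel M z₀).atLatent y).doDist S (clusterState e cl z) (restrict ⁻¹' E)
          ∂(R.latentModel M z₀).latentLaw := by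
        refine R.map_clusterState_doDist_apply M z₀ S z (hrestrict hE) fun s t hst => ?_
        have heq : restrict s = restrict t := funext fun C => hst C C.2
        simp only [Set.mem_preimage, heq]
    _ = _ := lintegral_congr fun y => (Measure.map_apply hrestrict hE).symm

end ClusterRoles

/-! ### Absorption of nodes into clusters -/

namespace ClusterGraph

variable {N : Type u} {G : DAG N} {K K' : ClusterGraph N}

theorem Reachable.ne_of_adj (h : Reachable G K) {A B : Set N} (hAB : K.Adj A B) : A ≠ B := by
  cases h with
  | start =>
    obtain ⟨a, b, rfl, rfl, hab⟩ := hAB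
    exact fun h => G.not_adj_self b (by rwa [Set.singleton_injective h] at hab)
  | delete => exact hAB.2.2.1
  | merge => exact hAB.1

theorem Reachable.mem_nodes_of_adj (h : Reachable G K) {A B : Set N} (hAB : K.Adj A B) :
    B ∈ K.nodes := by
  induction h generalizing A B with
  | start =>
    obtain ⟨-, b, -, rfl, -⟩ := hAB
    exact ⟨b, rfl⟩
  | delete _ _ _ ih =>
    obtain ⟨-, hB, -, h | h⟩ := hAB
    · exact ⟨ih h, hB⟩
    · exact ⟨ih h.2, hB⟩
  | merge _ _ _ _ ih =>
    obtain ⟨-, A₀, B₀, h, -, rfl⟩ := hAB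
    exact ⟨B₀, ih h, rfl⟩

/-- `own a` is the node of `K` that has absorbed the node `a` of `G`, if any: a deleted node is
absorbed by its child, and is dropped if it has none. -/
structure IsOwner (G : DAG N) (K : ClusterGraph N) (own : N → Option (Set N)) : Prop where
  mem_nodes : ∀ {a A}, own a = some A → A ∈ K.nodes
  own_of_mem : ∀ {a A}, A ∈ K.nodes → a ∈ A → own a = some A
  none_of_adj : ∀ {a b}, G.Adj a b → own a = none → own b = none
  eq_or_mem_of_adj : ∀ {a b A B}, G.Adj a b → own a = some A → own b = some B →
    A = B ∨ a ∈ A ∧ K.Adj A B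

theorem IsOwner.ofDAG (G : DAG N) : IsOwner G (ofDAG G) fun a => some {a} where
  mem_nodes {a A} h := ⟨a, Option.some.inj h⟩
  own_of_mem := by rintro a _ ⟨b, rfl⟩ rfl; rfl
  none_of_adj _ h := nomatch h
  eq_or_mem_of_adj {a b A B} hab ha hb := by
    obtain rfl := Option.some.inj ha
    obtain rfl := Option.some.inj hb
    exact Or.inr ⟨rfl, a, b, rfl, rfl, hab⟩

theorem IsOwner.bind {own : N → Option (Set N)} (h : IsOwner G K own)
    {φ : Set N → Option (Set N)}
    (hnodes : ∀ {A A'}, A ∈ K.nodes → φ A = some A' → A' ∈ K'.nodes)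
    (hmem : ∀ {a A'}, A' ∈ K'.nodes → a ∈ A' → ∃ A ∈ K.nodes, a ∈ A ∧ φ A = some A')
    (hnone : ∀ {A B}, K.Adj A B → φ A = none → φ B = none)
    (hadj : ∀ {A B A' B'}, K.Adj A B → φ A = some A' → φ B = some B' →
      A' = B' ∨ A ⊆ A' ∧ K'.Adj A' B') :
    IsOwner G K' fun a => (own a).bind φ where
  mem_nodes hA' := by
    obtain ⟨A, hA, hAA'⟩ := Option.bind_eq_some_iff.1 hA'
    exact hnodes (h.mem_nodes hA) hAA'
  own_of_mem hA' ha := by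
    obtain ⟨A, hA, haA, hAA'⟩ := hmem hA' ha
    rw [h.own_of_mem hA haA, Option.bind_some, hAA']
  none_of_adj {a b} hab ha := by
    rcases hb : own b with _ | B
    · rfl
    rcases hA : own a with _ | A
    · simp [h.none_of_adj hab hA] at hb
    rw [hA, Option.bind_some] at ha
    rcases h.eq_or_mem_of_adj hab hA hb with rfl | ⟨-, hAB⟩
    · exact ha
    · exact hnone hAB ha
  eq_or_mem_of_adj hab ha hb := by
    obtain ⟨A, hA, hAA'⟩ := Option.bind_eq_some_iff.1 ha
    obtain ⟨B, hB, hBB'⟩ := Option.bind_eq_some_iff.1 hb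
    rcases h.eq_or_mem_of_adj hab hA hB with rfl | ⟨haA, hAB⟩
    · exact Or.inl (Option.some.inj (hAA'.symm.trans hBB'))
    · exact (hadj hAB hAA' hBB').imp_right (And.imp_left fun hsub => hsub haA)

open Classical in
theorem IsOwner.delete {own : N → Option (Set N)} (h : IsOwner G K own) {A : Set N}
    {o : Option (Set N)} (ho : ∀ B, K.Adj A B ↔ o = some B)
    (hnodes : ∀ {B}, K.Adj A B → B ∈ K.nodes) (hne : ∀ {B}, K.Adj A B → A ≠ B) :
    IsOwner G (K.delete A) fun a => (own a).bind fun B => if B = A then o else some B := by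
  refine h.bind ?_ ?_ ?_ ?_
  · intro B B' hB hBB'
    split_ifs at hBB' with hBA
    · have hAB' := (ho B').2 hBB'
      exact ⟨hnodes hAB', (hne hAB').symm⟩
    · obtain rfl := Option.some.inj hBB'
      exact ⟨hB, hBA⟩
  · exact fun {a B} hB ha => ⟨B, hB.1, ha, if_neg hB.2⟩
  · intro B C hBC hB
    split_ifs at hB with hBA
    subst hBA
    simp [(ho C).1 hBC] at hB
  · intro B C B' C' hBC hB hC
    by_cases hBA : B = A
    · subst hBA
      have hCA : C ≠ B := (hne hBC).symm
      rw [if_pos rfl, (ho C).1 hBC] at hB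
      rw [if_neg hCA] at hC
      exact Or.inl (Option.some.inj (hB.symm.trans hC))
    · rw [if_neg hBA] at hB
      obtain rfl := Option.some.inj hB
      refine or_iff_not_imp_left.2 fun hBC' => ⟨subset_rfl, hBA, ?_⟩
      split_ifs at hC with hCA
      · subst hCA
        have hAC' := (ho C').2 hC
        exact ⟨(hne hAC').symm, hBC', Or.inr ⟨hBC, hAC'⟩⟩
      · obtain rfl := Option.some.inj hC
        exact ⟨hCA, hBC', Or.inl hBC⟩

theorem subset_mergeMap (A B E : Set N) : E ⊆ mergeMap A B E := by
  unfold mergeMap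
  split_ifs with hE
  · rcases hE with rfl | rfl
    exacts [Set.subset_union_left, Set.subset_union_right]
  · exact subset_rfl

theorem exists_mem_of_mem_mergeMap {A B E : Set N} (hA : A ∈ K.nodes) (hB : B ∈ K.nodes)
    (hE : E ∈ K.nodes) {a : N} (ha : a ∈ mergeMap A B E) :
    ∃ C ∈ K.nodes, a ∈ C ∧ mergeMap A B C = mergeMap A B E := by
  by_cases hEAB : E = A ∨ E = B
  · have hmerge : mergeMap A B E = A ∪ B := if_pos hEAB
    rw [hmerge] at ha ⊢
    rcases ha with ha | ha
    exacts [⟨A, hA, ha, if_pos (Or.inl rfl)⟩, ⟨B, hB, ha, if_pos (Or.inr rfl)⟩]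
  · exact ⟨E, hE, by rwa [mergeMap, if_neg hEAB] at ha, rfl⟩

theorem IsOwner.merge {own : N → Option (Set N)} (h : IsOwner G K own) {A B : Set N}
    (hA : A ∈ K.nodes) (hB : B ∈ K.nodes) :
    IsOwner G (K.merge A B) fun a => (own a).bind fun E => some (mergeMap A B E) := by
  refine h.bind ?_ ?_ (fun _ h => nomatch h) ?_
  · rintro E _ hE ⟨⟩
    exact ⟨E, hE, rfl⟩
  · rintro a _ ⟨E, hE, rfl⟩ ha
    obtain ⟨C, hC, haC, hCE⟩ := exists_mem_of_mem_mergeMap hA hB hE ha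
    exact ⟨C, hC, haC, congrArg some hCE⟩
  · rintro C D _ _ hCD ⟨⟩ ⟨⟩
    exact or_iff_not_imp_left.2 fun hne => ⟨subset_mergeMap A B C, hne, C, D, hCD, rfl, rfl⟩

theorem Reachable.exists_isOwner (h : Reachable G K) : ∃ own, IsOwner G K own := by
  induction h with
  | start => exact ⟨_, .ofDAG G⟩
  | @delete K A hK _ hchild ih =>
    obtain ⟨own, ih⟩ := ih
    obtain ⟨o, ho⟩ : ∃ o : Option (Set N), ∀ B, K.Adj A B ↔ o = some B := by
      by_cases hA : ∃ B, K.Adj A B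
      · obtain ⟨B, hB⟩ := hA
        refine ⟨some B, fun C => ⟨fun hC => congrArg some (hchild B C hB hC), ?_⟩⟩
        rintro ⟨⟩
        exact hB
      · exact ⟨none, fun B => ⟨fun hB => absurd ⟨B, hB⟩ hA, fun h => nomatch h⟩⟩
    exact ⟨_, ih.delete ho hK.mem_nodes_of_adj hK.ne_of_adj⟩
  | merge _ hA hB _ ih =>
    obtain ⟨own, ih⟩ := ih
    exact ⟨_, ih.merge hA hB⟩

end ClusterGraph

/-- `own a` is the node of `H` that has absorbed the node `a` of `G`, if any, where the node `A` of
`H` stands for the cluster `c A`. -/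
structure IsAbsorption {N : Type u} {N' : Type v} (G : DAG N) (H : DAG N') (c : N' → Set N)
    (own : N → Option N') : Prop where
  own_of_mem : ∀ {a A}, a ∈ c A → own a = some A
  none_of_adj : ∀ {a b}, G.Adj a b → own a = none → own b = none
  eq_or_mem_of_adj : ∀ {a b A B}, G.Adj a b → own a = some A → own b = some B →
    A = B ∨ a ∈ c A ∧ H.Adj A B

theorem IsGraphicalAbstraction.exists_isAbsorption {N : Type u} {N' : Type v} {G : DAG N}
    {H : DAG N'} {c : N' → Set N} (h : IsGraphicalAbstraction G H c) :
    ∃ own, IsAbsorption G H c own := by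
  obtain ⟨K, hK, hc, hrange, hadj⟩ := h
  obtain ⟨own, hown⟩ := hK.exists_isOwner
  have hnode : ∀ {a A}, own a = some A → ∃ A', c A' = A := fun ha =>
    hrange.symm.subset (hown.mem_nodes ha)
  have hsome : ∀ {a A}, (own a).bind (Function.partialInv c) = some A ↔ own a = some (c A) := by
    simp [Option.bind_eq_some_iff, hc.isPartialInv _ _]
  have hnone : ∀ {a}, (own a).bind (Function.partialInv c) = none ↔ own a = none := by
    intro a
    refine ⟨fun ha => ?_, fun ha => by rw [ha, Option.bind_none]⟩
    by_contra hne
    obtain ⟨A, hA⟩ := Option.ne_none_iff_exists'.1 hne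
    obtain ⟨A', rfl⟩ := hnode hA
    simp [hsome.2 hA] at ha
  refine ⟨fun a => (own a).bind (Function.partialInv c), ?_, ?_, ?_⟩
  · exact fun ha => hsome.2 (hown.own_of_mem (hrange ▸ ⟨_, rfl⟩) ha)
  · exact fun hab ha => hnone.2 (hown.none_of_adj hab (hnone.1 ha))
  · intro a b A B hab ha hb
    rw [hadj]
    exact (hown.eq_or_mem_of_adj hab (hsome.1 ha) (hsome.1 hb)).imp_left fun h => hc h

/-! ### Cluster roles from abstractions between mixed graphs -/

namespace DAG.HasLatentProjection

variable {V : Type u} {U : Type v} {G : DAG (V ⊕ U)} {L : ADMG V} (h : G.HasLatentProjection L)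
include h

theorem latentPath_iff {a b : V ⊕ U} : G.LatentPath a b ↔ G.Adj a b := by
  refine ⟨fun hab => ?_, .edge⟩
  cases hab with
  | edge hab => exact hab
  | cons hal _ => exact absurd hal (h.exogenous _ _)

theorem adj_iff {a b : V} : L.Adj a b ↔ G.Adj (Sum.inl a) (Sum.inl b) := by
  rw [h.dir_iff, h.latentPath_iff]

theorem bi_iff_adj {a b : V} :
    L.bi a b ↔ a ≠ b ∧ ∃ l : U, G.Adj (Sum.inr l) (Sum.inl a) ∧ G.Adj (Sum.inr l) (Sum.inl b) := by
  simp only [h.bi_iff, h.latentPath_iff]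

theorem eq_or_bi_of_adj {l : U} {a b : V} (ha : G.Adj (Sum.inr l) (Sum.inl a))
    (hb : G.Adj (Sum.inr l) (Sum.inl b)) : a = b ∨ L.bi a b :=
  or_iff_not_imp_left.2 fun hab => h.bi_iff_adj.2 ⟨hab, l, ha, hb⟩

end DAG.HasLatentProjection

/-- An absorption of the nodes of `L` by the nodes of `H` and by latent variables `j : J` of `H`,
where `Emits j C` means that `j` is a parent of `C`. The latent variables of `L` enter only through
its bidirected edges, so that the conditions apply to every DAG with latent projection `L`. -/
structure ADMGAbsorption {V : Type u} {W : Type w} (L : ADMG V) (H : ADMG W) (cl : W → Set V)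
    (J : Type*) where
  own : V → Option (W ⊕ J)
  Emits : J → W → Prop
  own_of_mem : ∀ {a C}, a ∈ cl C → own a = some (Sum.inl C)
  none_of_adj : ∀ {a b}, L.Adj a b → own a = none → own b = none
  eq_or_mem_of_adj : ∀ {a b C D}, L.Adj a b → own a = some (Sum.inl C) →
    own b = some (Sum.inl D) → C = D ∨ a ∈ cl C ∧ H.Adj C D
  latent_of_adj : ∀ {a b j}, L.Adj a b → own b = some (Sum.inr j) → own a = some (Sum.inr j)
  emits_of_adj : ∀ {a b j C}, L.Adj a b → own a = some (Sum.inr j) → own b = some (Sum.inl C) →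
    Emits j C
  emits_of_bi : ∀ {a b j C}, L.bi a b → own a = some (Sum.inr j) → own b = some (Sum.inl C) →
    Emits j C
  latent_eq_of_bi : ∀ {a b j k}, L.bi a b → own a = some (Sum.inr j) → own b = some (Sum.inr k) →
    j = k
  eq_or_bi_of_bi : ∀ {a b C D}, L.bi a b → own a = some (Sum.inl C) → own b = some (Sum.inl D) →
    C = D ∨ H.bi C D
  bi_iff : ∀ {C D}, H.bi C D ↔ C ≠ D ∧ ∃ j, Emits j C ∧ Emits j D

namespace IsAbsorption

variable {V : Type u} {U : Type v} {W : Type w} {J : Type*} {G : DAG (V ⊕ U)} {G' : DAG (W ⊕ J)}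
  {L : ADMG V} {H : ADMG W} {cl : W → Set V} {c : W ⊕ J → Set (V ⊕ U)}
  {own : V ⊕ U → Option (W ⊕ J)} (h : IsAbsorption G G' c own)
include h

theorem latent_of_adj (hG' : G'.HasLatentProjection H) {a b : V ⊕ U} {j : J} (hab : G.Adj a b)
    (hb : own b = some (Sum.inr j)) : own a = some (Sum.inr j) := by
  rcases ha : own a with _ | A
  · simp [h.none_of_adj hab ha] at hb
  · rcases h.eq_or_mem_of_adj hab ha hb with rfl | ⟨-, hA⟩
    · rfl
    · exact absurd hA (hG'.exogenous _ _)

theorem adj_of_adj {a b : V ⊕ U} {j : J} {C : W} (hab : G.Adj a b)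
    (ha : own a = some (Sum.inr j)) (hb : own b = some (Sum.inl C)) :
    G'.Adj (Sum.inr j) (Sum.inl C) := by
  rcases h.eq_or_mem_of_adj hab ha hb with heq | ⟨-, hadj⟩
  · cases heq
  · exact hadj

theorem own_latent (hc : ∀ C, c (Sum.inl C) = Sum.inl '' cl C) {l : U} {b : V ⊕ U} {C : W}
    (hlb : G.Adj (Sum.inr l) b) (hb : own b = some (Sum.inl C)) :
    own (Sum.inr l) = some (Sum.inl C) ∨
      ∃ j, own (Sum.inr l) = some (Sum.inr j) ∧ G'.Adj (Sum.inr j) (Sum.inl C) := by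
  rcases hl : own (Sum.inr l) with _ | D | j
  · simp [h.none_of_adj hlb hl] at hb
  · rcases h.eq_or_mem_of_adj hlb hl hb with heq | ⟨hmem, -⟩
    · exact Or.inl (congrArg some heq)
    · simp [hc] at hmem
  · exact Or.inr ⟨j, rfl, h.adj_of_adj hlb hl hb⟩

theorem eq_or_bi_of_bi (hG : G.HasLatentProjection L) (hG' : G'.HasLatentProjection H)
    (hc : ∀ C, c (Sum.inl C) = Sum.inl '' cl C) {a b : V} {C D : W} (hab : L.bi a b)
    (ha : own (Sum.inl a) = some (Sum.inl C)) (hb : own (Sum.inl b) = some (Sum.inl D)) :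
    C = D ∨ H.bi C D := by
  obtain ⟨-, l, hla, hlb⟩ := hG.bi_iff_adj.1 hab
  rcases h.own_latent hc hla ha with hl | ⟨j, hl, hjC⟩ <;>
    rcases h.own_latent hc hlb hb with hl' | ⟨k, hl', hkD⟩ <;>
    cases hl.symm.trans hl'
  · exact Or.inl rfl
  · exact hG'.eq_or_bi_of_adj hjC hkD

/-- The absorption of the endogenous nodes when both DAGs are replaced by their latent
projections. -/
def admgAbsorption (hG : G.HasLatentProjection L) (hG' : G'.HasLatentProjection H)
    (hc : ∀ C, c (Sum.inl C) = Sum.inl '' cl C) : ADMGAbsorption L H cl J where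
  own a := own (Sum.inl a)
  Emits j C := G'.Adj (Sum.inr j) (Sum.inl C)
  own_of_mem {a C} ha := h.own_of_mem (hc C ▸ Set.mem_image_of_mem _ ha)
  none_of_adj hab := h.none_of_adj (hG.adj_iff.1 hab)
  eq_or_mem_of_adj {a b C D} hab ha hb := by
    rw [hG'.adj_iff, ← Sum.inl_injective.eq_iff (a := C), ← Sum.inl_injective.mem_set_image, ← hc]
    exact h.eq_or_mem_of_adj (hG.adj_iff.1 hab) ha hb
  latent_of_adj hab := h.latent_of_adj hG' (hG.adj_iff.1 hab)
  emits_of_adj hab := h.adj_of_adj (hG.adj_iff.1 hab)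
  emits_of_bi hab ha hb := by
    obtain ⟨-, l, hla, hlb⟩ := hG.bi_iff_adj.1 hab
    exact h.adj_of_adj hlb (h.latent_of_adj hG' hla ha) hb
  latent_eq_of_bi hab ha hb := by
    obtain ⟨-, l, hla, hlb⟩ := hG.bi_iff_adj.1 hab
    cases (h.latent_of_adj hG' hla ha).symm.trans (h.latent_of_adj hG' hlb hb)
    rfl
  eq_or_bi_of_bi := h.eq_or_bi_of_bi hG hG' hc
  bi_iff := hG'.bi_iff_adj

end IsAbsorption

namespace ADMGAbsorption

variable {V : Type u} {U : Type v} {W : Type w} {J : Type*} {L : ADMG V} {H : ADMG W}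
  {cl : W → Set V} (K : ADMGAbsorption L H cl J) {G : DAG (V ⊕ U)}

open Classical in
/-- The block of latent variables to which the exogenous node `l` of `G` is assigned: the block
`j` if `j` has absorbed a child of `l`, and a block of its own otherwise. The lift only serves to
meet the universe of the index type in the main theorem. -/
noncomputable def latentIndex (G : DAG (V ⊕ U)) (l : U) : ULift.{w} J ⊕ U :=
  if h : ∃ j a, G.Adj (Sum.inr l) (Sum.inl a) ∧ K.own a = some (Sum.inr j) then
    Sum.inl (ULift.up h.choose)
  else Sum.inr l

theorem exists_of_latentIndex_eq_inl {l : U} {j : ULift.{w} J}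
    (hl : K.latentIndex G l = Sum.inl j) :
    ∃ a, G.Adj (Sum.inr l) (Sum.inl a) ∧ K.own a = some (Sum.inr j.down) := by
  unfold latentIndex at hl
  split_ifs at hl with h
  cases hl
  exact h.choose_spec

theorem eq_of_latentIndex_eq_inr {l l' : U} (hl : K.latentIndex G l = Sum.inr l') : l = l' := by
  unfold latentIndex at hl
  split_ifs at hl
  exact Sum.inr_injective hl

theorem latentIndex_eq_inl (hG : G.HasLatentProjection L) {l : U} {a : V} {j : J}
    (hla : G.Adj (Sum.inr l) (Sum.inl a)) (ha : K.own a = some (Sum.inr j)) :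
    K.latentIndex G l = Sum.inl (ULift.up j) := by
  have h : ∃ j a, G.Adj (Sum.inr l) (Sum.inl a) ∧ K.own a = some (Sum.inr j) := ⟨j, a, hla, ha⟩
  obtain ⟨b, hlb, hb⟩ := h.choose_spec
  have hj : h.choose = j := by
    rcases hG.eq_or_bi_of_adj hlb hla with rfl | hba
    · exact Sum.inr_injective (Option.some.inj (hb.symm.trans ha))
    · exact K.latent_eq_of_bi hba hb ha
  rw [latentIndex, dif_pos h, hj]

/-- The endogenous nodes have the role of the node of `H` or the latent variable that has absorbed
them. -/
noncomputable def role (G : DAG (V ⊕ U)) : V ⊕ U → Option (W ⊕ (ULift.{w} J ⊕ U)) :=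
  Sum.elim (fun a => (K.own a).map (Sum.map id (Sum.inl ∘ ULift.up)))
    fun l => some (Sum.inr (K.latentIndex G l))

/-- The blocks of latent variables that have an edge to the cluster `C`. -/
def lat (G : DAG (V ⊕ U)) (C : W) : Set (ULift.{w} J ⊕ U) :=
  {i | Sum.elim (fun j => K.Emits j.down C)
    (fun l => ∃ a, G.Adj (Sum.inr l) (Sum.inl a) ∧ K.own a = some (Sum.inl C)) i}

theorem role_inl_eq_none {a : V} : K.role G (Sum.inl a) = none ↔ K.own a = none := by
  simp [role]

theorem role_inl_eq_cluster {a : V} {C : W} :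
    K.role G (Sum.inl a) = some (Sum.inl C) ↔ K.own a = some (Sum.inl C) := by
  simp [role]

theorem role_inl_eq_latent {a : V} {i : ULift.{w} J ⊕ U} :
    K.role G (Sum.inl a) = some (Sum.inr i) ↔
      ∃ j, K.own a = some (Sum.inr j) ∧ Sum.inl (ULift.up j) = i := by
  simp [role]

theorem role_inr_eq_latent {l : U} {i : ULift.{w} J ⊕ U} :
    K.role G (Sum.inr l) = some (Sum.inr i) ↔ K.latentIndex G l = i := by
  simp [role]

theorem role_latent_of_adj (hG : G.HasLatentProjection L) {a : V ⊕ U} {b : V}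
    {i : ULift.{w} J ⊕ U} (hab : G.Adj a (Sum.inl b))
    (hb : K.role G (Sum.inl b) = some (Sum.inr i)) : K.role G a = some (Sum.inr i) := by
  obtain ⟨j, hj, rfl⟩ := K.role_inl_eq_latent.1 hb
  rcases a with a | l
  · exact K.role_inl_eq_latent.2 ⟨j, K.latent_of_adj (hG.adj_iff.2 hab) hj, rfl⟩
  · exact K.role_inr_eq_latent.2 (K.latentIndex_eq_inl hG hab hj)

theorem mem_lat_of_adj (hG : G.HasLatentProjection L) {a : V ⊕ U} {b : V} {i : ULift.{w} J ⊕ U}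
    {C : W} (hab : G.Adj a (Sum.inl b)) (ha : K.role G a = some (Sum.inr i))
    (hb : K.own b = some (Sum.inl C)) : i ∈ K.lat G C := by
  rcases a with a | l
  · obtain ⟨j, hj, rfl⟩ := K.role_inl_eq_latent.1 ha
    exact K.emits_of_adj (hG.adj_iff.2 hab) hj hb
  · rw [role_inr_eq_latent] at ha
    rcases i with j | l'
    · obtain ⟨a, hla, haj⟩ := K.exists_of_latentIndex_eq_inl ha
      rcases hG.eq_or_bi_of_adj hla hab with rfl | hbi
      · cases haj.symm.trans hb
      · exact K.emits_of_bi hbi haj hb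
    · obtain rfl := K.eq_of_latentIndex_eq_inr ha
      exact ⟨b, hab, hb⟩

/-- The roles with respect to the clusters `cl` of the nodes of a DAG with latent projection
`L`. -/
noncomputable def clusterRoles (hG : G.HasLatentProjection L) :
    ClusterRoles G H Sum.inl cl (ULift.{w} J ⊕ U) where
  role := K.role G
  lat := K.lat G
  role_of_mem ha := K.role_inl_eq_cluster.2 (K.own_of_mem ha)
  latent_of_adj {a b i} hab hb := by
    rcases b with b | l
    · exact K.role_latent_of_adj hG hab hb
    · exact absurd hab (hG.exogenous _ _)
  mem_lat_of_adj {a b i C} hab ha hb := by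
    rcases b with b | l
    · exact K.mem_lat_of_adj hG hab ha (K.role_inl_eq_cluster.1 hb)
    · exact absurd hab (hG.exogenous _ _)
  eq_or_mem_of_adj {a b C D} hab ha hb := by
    rcases a with a | l
    · rcases b with b | l
      · rw [role_inl_eq_cluster] at ha hb
        exact (K.eq_or_mem_of_adj (hG.adj_iff.2 hab) ha hb).imp_right
          (And.imp_left (Set.mem_image_of_mem _))
      · exact absurd hab (hG.exogenous _ _)
    · cases ha
  none_of_adj {a b} hab ha := by
    rcases a with a | l
    · rcases b with b | l
      · exact K.role_inl_eq_none.2 (K.none_of_adj (hG.adj_iff.2 hab) (K.role_inl_eq_none.1 ha))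
      · exact absurd hab (hG.exogenous _ _)
    · cases ha

theorem lat_inter_nonempty_iff (hG : G.HasLatentProjection L) {C D : W} (hne : C ≠ D) :
    (K.lat G C ∩ K.lat G D).Nonempty ↔ H.bi C D := by
  constructor
  · rintro ⟨j | l, hC, hD⟩
    · exact K.bi_iff.2 ⟨hne, j.down, hC, hD⟩
    · obtain ⟨a, hla, ha⟩ := hC
      obtain ⟨b, hlb, hb⟩ := hD
      rcases hG.eq_or_bi_of_adj hla hlb with rfl | hab
      · exact absurd (Sum.inl_injective (Option.some.inj (ha.symm.trans hb))) hne
      · exact (K.eq_or_bi_of_bi hab ha hb).resolve_left hne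
  · intro h
    obtain ⟨-, j, hC, hD⟩ := K.bi_iff.1 h
    exact ⟨Sum.inl (ULift.up j), hC, hD⟩

end ADMGAbsorption

theorem mainTheorem4 {V : Type u} {U : Type v} {W : Type w} [Finite V] [Finite U] [Finite W]
    (X : V ⊕ U → Type x) [∀ a, MeasurableSpace (X a)]
    (L' : DAG (V ⊕ U)) (M : CBN L' X) (L : ADMG V) (hL : L'.HasLatentProjection L)
    (H : ADMG W) (cl : W → Set V) (hH : IsADMGAbstraction L H cl) :
    ∃ F : ADMG.LatentModel.{w, max v w, max u v x, max u x} H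
        (fun C => ∀ a : cl C, X (Sum.inl a)),
      (∀ C C' : W, C ≠ C' → ((F.lat C ∩ F.lat C').Nonempty ↔ H.bi C C')) ∧
      ∀ (S : Set W) (z : ∀ a, X a)
        (E : Set (∀ C : (Sᶜ : Set W), ∀ a : cl C, X (Sum.inl a))), MeasurableSet E →
        (M.doDist (⋃ C ∈ S, Sum.inl '' cl C) z).map
            (fun y (C : (Sᶜ : Set W)) (a : cl C) => y (Sum.inl a)) E =
          ∫⁻ y, ((F.atLatent y).doDist S (fun C a => z (Sum.inl a))).map
            (fun t (C : (Sᶜ : Set W)) => t C) E ∂F.latentLaw := by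
  obtain ⟨m, n, G, G', c, hG, hG', habs, hc⟩ := hH
  obtain ⟨own, hown⟩ := habs.exists_isAbsorption
  let K := hown.admgAbsorption hG hG' hc
  let R := K.clusterRoles hL
  obtain ⟨z₀⟩ := M.nonempty_states
  have := Fintype.ofFinite (ULift.{w} (Fin n) ⊕ U)
  exact ⟨R.latentModel M z₀, fun C C' hne => K.lat_inter_nonempty_iff hL hne,
    fun S z E hE => R.map_doDist_apply M z₀ S z hE⟩
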